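/- Consider finite simple undirected graphs $G=(V,E,w)$ on $V=\{1,\dots,n\}$ with edge weights $w_e\ge 0$. Let $w_{\max}$ be the largest edge weight and $w_{\min}$ the smallest non-zero edge weight of $G$ (put $\log(w_{\max}/w_{\min})=0$ if $G$ has no edge of non-zero weight). Let $\mathrm{dist}_G(u,v)\in[0,\infty]$ be the shortest-path distance in $G$, with $\mathrm{dist}_G(u,v)=\infty$ if $u$ and $v$ are not connected in $G$. There are absolute constants $C>0$ and $c\in\mathbb N$ such that, for all integers $n$ and $f$ with $1\le f\le\binom n2$, there is a deterministic data structure (an encoding of each weighted graph on $n$ vertices as a finite bit string, together with a query procedure) with the following two properties for every weighted graph $G=(V,E,w)$ on $n$ vertices. 1. It stores at most $C(\log n)^c\cdot n\sqrt f\cdot\bigl(1+\log(w_{\max}/w_{\min})\bigr)$ bits, that is, $\widetilde O\bigl(n\sqrt f\,(1+\log(w_{\max}/w_{\min}))\bigr)$ bits. 2. For every $F\subseteq\{(e,w_e):e\in E\}$ with $|F|\le f$ and all $u,v\in V$, the query, given only the stored bits, $F$, $u$, $v$ and the unit of length $w_{\min}$, returns a value $\widehat{\mathrm{dist}}_{G-F}(u,v)\in[0,\infty]$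 with $$\mathrm{dist}_{G-F}(u,v)\le\widehat{\mathrm{dist}}_{G-F}(u,v)\le C\log n\cdot\max\{1,\log\log n\}\cdot\mathrm{dist}_{G-F}(u,v),$$ where $G-F$ is $G$ without the edges listed in $F$. -/

import Mathlib

open scoped NNReal ENNReal

/-- A finite simple undirected graph on the vertex set `Fin n` with non-negative real edge weights.
Only the values of `weight` on edges of `graph` are ever used to define distances. -/
structure WeightedGraph (n : ℕ) where
  graph : SimpleGraph (Fin n)
  weight : Sym2 (Fin n) → ℝ≥0

namespace WeightedGraph

variable {n : ℕ}

/-- The set of weights of the edges of `G`. -/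
def weights (G : WeightedGraph n) : Set ℝ≥0 :=
  G.weight '' G.graph.edgeSet

/-- The largest edge weight (the set of weights is finite; the value is `0` if there are no
edges). -/
noncomputable def wMax (G : WeightedGraph n) : ℝ≥0 :=
  sSup G.weights

/-- The smallest non-zero edge weight (the set of weights is finite; the value is `0` if there is
no edge of non-zero weight). -/
noncomputable def wMin (G : WeightedGraph n) : ℝ≥0 :=
  sInf {x | x ∈ G.weights ∧ x ≠ 0}

/-- The shortest-path distance: the infimum over all walks of the total edge weight, which is `∞`
if there is no walk. -/
noncomputable def dist (G : WeightedGraph n) (u v : Fin n) : ℝ≥0∞ :=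
  ⨅ p : G.graph.Walk u v, (((p.edges.map G.weight).sum : ℝ≥0) : ℝ≥0∞)

/-- A deletion request: a finite set of pairs (edge, weight). It is admissible for `G` if every pair
consists of an edge of `G` and the weight of this edge in `G`. -/
def Admissible (G : WeightedGraph n) (F : Finset (Sym2 (Fin n) × ℝ≥0)) : Prop :=
  ∀ p ∈ F, p.1 ∈ G.graph.edgeSet ∧ p.2 = G.weight p.1

/-- The weighted graph `G - F`. -/
def delete (G : WeightedGraph n) (F : Finset (Sym2 (Fin n) × ℝ≥0)) : WeightedGraph n where
  graph := G.graph.deleteEdges (Prod.fst '' (F : Set (Sym2 (Fin n) × ℝ≥0)))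
  weight := G.weight

end WeightedGraph

/-- A deterministic data structure for weighted graphs on `n` vertices. `encode` turns a graph into
the stored string of bits. `query` sees only the unit of length (the smallest non-zero weight of the
graph), the stored bits, the deletion request and the two vertices. -/
structure OracleScheme (n : ℕ) where
  encode : WeightedGraph n → List Bool
  query : ℝ≥0 → List Bool → Finset (Sym2 (Fin n) × ℝ≥0) → Fin n → Fin n → ℝ≥0∞

namespace OracleScheme

variable {n : ℕ}

/-- The value reported for `G`, the deletions `F` and the vertices `u`, `v`. -/
noncomputable def report (S : OracleScheme n) (G : WeightedGraph n)
    (F : Finset (Sym2 (Fin n) × ℝ≥0)) (u v : Fin n) : ℝ≥0∞ :=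
  S.query G.wMin (S.encode G) F u v

/-- `S` is an `f`-fault-tolerant `t`-distance oracle. -/
def IsFaultTolerant (S : OracleScheme n) (f : ℕ) (t : ℝ≥0∞) : Prop :=
  ∀ (G : WeightedGraph n) (F : Finset (Sym2 (Fin n) × ℝ≥0)), G.Admissible F → F.card ≤ f →
    ∀ u v : Fin n,
      (G.delete F).dist u v ≤ S.report G F u v ∧
      S.report G F u v ≤ t * (G.delete F).dist u v

end OracleScheme

/-! Edges are split into weight classes by powers of two of the unit, with a separate class for
weight zero. Each class is encoded as an unweighted graph, and replacing an edge by a detour inside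
its class costs only the length of the detour and a factor 2.

For one unweighted graph put `q = Nat.sqrt f + 1`, so `f ≤ q * q`. Clusters `U i` maximising
`adjCount G U U / (U.card * logWeight U.card)` are removed greedily until about `q * n * log n`
adjacencies remain, and these are stored explicitly (`exists_clusters`). A removed cluster pays for
its size with the edges it removes, so the cluster sizes sum to about `n * log n ^ 2`. For each
vertex of each cluster only the degree and a colour of its neighbourhood are stored, where two
different sets whose symmetric difference has at most `8 * q` elements get different colours; this
takes about `q * log n` bits (`exists_finset_coloring`).

Let two graphs share a code and contain the same deletions. A vertex with fewer than `4 * q`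
surviving neighbours in its cluster has the same neighbourhood there in both graphs, by its colour.
Two vertices with at least `4 * q` survivors each are joined by a short path: maximality of the
density gives a set `S` with `S.card * 2 ^ k ≤ U.card` a boundary proportional to `k * S.card`,
which `f` deletions cannot destroy once `S.card ≥ 4 * q`. Balls therefore exceed half the cluster
within `growthTime l`, about `l * log l` steps with `l` about `log n`, and two such balls meet
(`IsDensest.exists_walk`).

Hence graphs with equal codes have similar distances after deletion, and a query may answer with the
supremum over all graphs consistent with its input. -/

/-! ### Expansion of densest sets and its robustness under deletions -/

section Expansion

variable {V : Type*}

/-- The number of ordered pairs in `S × T` that are adjacent in `G`. -/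
noncomputable def adjCount (G : SimpleGraph V) (S T : Finset V) : ℕ :=
  open Classical in ∑ x ∈ S, ∑ y ∈ T, if G.Adj x y then 1 else 0

lemma adjCount_mono {G H : SimpleGraph V} (h : G ≤ H) {S S' T T' : Finset V}
    (hS : S ⊆ S') (hT : T ⊆ T') : adjCount G S T ≤ adjCount H S' T' := by
  classical
  unfold adjCount
  refine (Finset.sum_le_sum_of_subset hS).trans (Finset.sum_le_sum fun x _ => ?_)
  refine (Finset.sum_le_sum_of_subset hT).trans (Finset.sum_le_sum fun y _ => ?_)
  by_cases hxy : G.Adj x y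
  · simp [hxy, h hxy]
  · simp [hxy]

lemma adjCount_congr {G H : SimpleGraph V} {S T : Finset V}
    (h : ∀ x ∈ S, ∀ y ∈ T, (G.Adj x y ↔ H.Adj x y)) : adjCount G S T = adjCount H S T := by
  classical
  unfold adjCount
  exact Finset.sum_congr rfl fun x hx => Finset.sum_congr rfl fun y hy => by simp [h x hx y hy]

lemma adjCount_comm (G : SimpleGraph V) (S T : Finset V) : adjCount G S T = adjCount G T S := by
  classical
  unfold adjCount
  rw [Finset.sum_comm]
  simp [G.adj_comm]

lemma adjCount_add_sdiff_right [DecidableEq V] (G : SimpleGraph V) (S : Finset V) {T U : Finset V}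
    (h : T ⊆ U) : adjCount G S T + adjCount G S (U \ T) = adjCount G S U := by
  classical
  unfold adjCount
  rw [← Finset.sum_add_distrib]
  refine Finset.sum_congr rfl fun x _ => ?_
  rw [add_comm]
  convert Finset.sum_sdiff h

lemma adjCount_self_eq [DecidableEq V] (G : SimpleGraph V) {S U : Finset V} (h : S ⊆ U) :
    adjCount G U U = adjCount G S S + 2 * adjCount G S (U \ S) + adjCount G (U \ S) (U \ S) := by
  have h1 := adjCount_add_sdiff_right G U h
  have h2 := adjCount_add_sdiff_right G S h
  have h3 := adjCount_add_sdiff_right G (U \ S) h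
  rw [adjCount_comm G U S, adjCount_comm G U (U \ S)] at h1
  rw [adjCount_comm G (U \ S) S] at h3
  omega

lemma adjCount_eq_card (G : SimpleGraph V) (S T : Finset V) :
    adjCount G S T = (open Classical in (S ×ˢ T).filter fun p => G.Adj p.1 p.2).card := by
  classical
  unfold adjCount
  rw [Finset.card_filter, Finset.sum_product]

/-- Deleting `D` removes at most `D.card` pairs between disjoint sets. -/
lemma adjCount_le_deleteEdges_add_card (G : SimpleGraph V) (D : Finset (Sym2 V)) {S T : Finset V}
    (h : Disjoint S T) :
    adjCount G S T ≤ adjCount (G.deleteEdges D) S T + D.card := by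
  classical
  rw [adjCount_eq_card, adjCount_eq_card]
  have hsub : ((S ×ˢ T).filter fun p => G.Adj p.1 p.2) ⊆
      ((S ×ˢ T).filter fun p => (G.deleteEdges (D : Set (Sym2 V))).Adj p.1 p.2) ∪
        ((S ×ˢ T).filter fun p => s(p.1, p.2) ∈ D) := by
    intro p hp
    simp only [Finset.mem_filter, Finset.mem_union, SimpleGraph.deleteEdges_adj,
      Finset.mem_coe] at hp ⊢
    tauto
  refine (Finset.card_le_card hsub).trans ((Finset.card_union_le _ _).trans ?_)
  refine Nat.add_le_add (le_of_eq (by congr)) ?_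
  refine Finset.card_le_card_of_injOn (fun p => s(p.1, p.2)) (fun p hp => ?_) ?_
  · simpa using (Finset.mem_filter.1 hp).2
  -- Disjointness of `S` and `T` excludes the swapped pair, so each deleted edge accounts for one
  -- ordered pair.
  · rintro ⟨a, b⟩ hp ⟨a', b'⟩ hp' hab
    simp only [Finset.coe_filter, Finset.mem_product, Set.mem_ofPred_eq] at hp hp'
    rcases Sym2.eq_iff.1 hab with ⟨h1, h2⟩ | ⟨h1, h2⟩
    · simp only at h1 h2; rw [h1, h2]
    · simp only at h1 h2
      exact absurd (h1 ▸ hp.1.1) (fun hc => Finset.disjoint_left.1 h hc hp'.1.2)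

/-- The slowly growing weight `⌊log₂ x⌋ + 1` by which densities are normalised. -/
def logWeight (x : ℕ) : ℕ := Nat.log 2 x + 1

lemma logWeight_mono : Monotone logWeight := fun _ _ h =>
  Nat.add_le_add_right (Nat.log_mono_right h) 1

lemma logWeight_add_le {s k u : ℕ} (hs : s ≠ 0) (h : s * 2 ^ k ≤ u) :
    logWeight s + k ≤ logWeight u := by
  unfold logWeight
  have h2 : Nat.log 2 (s * 2 ^ k) = Nat.log 2 s + k := by
    induction k with
    | zero => simp
    | succ k ih =>
      rw [pow_succ, ← mul_assoc, Nat.log_mul_base (by norm_num) (by positivity),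
        ih (le_trans (Nat.mul_le_mul_left _ (Nat.pow_le_pow_right (by norm_num) (by omega))) h)]
      omega
  have := Nat.log_mono_right (b := 2) h
  omega

/-- `U` has normalised density `ρ` in `G`, and no subset of `U` is denser. -/
structure IsDensest (G : SimpleGraph V) (U : Finset V) (ρ : ℝ) : Prop where
  eq : (adjCount G U U : ℝ) = ρ * (U.card * logWeight U.card)
  le : ∀ S ⊆ U, (adjCount G S S : ℝ) ≤ ρ * (S.card * logWeight S.card)

lemma IsDensest.congr {G H : SimpleGraph V} {U : Finset V} {ρ : ℝ} (h : IsDensest G U ρ)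
    (hGH : ∀ x ∈ U, ∀ y ∈ U, (G.Adj x y ↔ H.Adj x y)) : IsDensest H U ρ where
  eq := by rw [← h.eq, adjCount_congr hGH]
  le S hS := by
    rw [← adjCount_congr fun x hx y hy => hGH x (hS hx) y (hS hy)]
    exact h.le S hS

lemma exists_isDensest [Fintype V] [Nonempty V] (G : SimpleGraph V) :
    ∃ (U : Finset V) (ρ : ℝ), U.Nonempty ∧ IsDensest G U ρ ∧
      (adjCount G Finset.univ Finset.univ : ℝ) ≤
        ρ * (Fintype.card V * logWeight (Fintype.card V)) := by
  classical
  obtain ⟨U, hU, hmax⟩ := Finset.exists_max_image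
    (Finset.univ.filter fun S : Finset V => S.Nonempty)
    (fun S => (adjCount G S S : ℝ) / (S.card * logWeight S.card))
    ⟨Finset.univ, by simp⟩
  simp only [Finset.mem_filter, Finset.mem_univ, true_and] at hU hmax
  have hpos : ∀ S : Finset V, S.Nonempty → (0 : ℝ) < S.card * logWeight S.card := by
    intro S hS
    have := hS.card_pos
    unfold logWeight
    positivity
  have hle : ∀ S : Finset V, S.Nonempty → (adjCount G S S : ℝ) ≤
      (adjCount G U U : ℝ) / (U.card * logWeight U.card) * (S.card * logWeight S.card) := by
    intro S hS
    exact (div_le_iff₀ (hpos S hS)).1 (hmax S hS)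
  refine ⟨U, _, hU, ⟨(div_mul_cancel₀ _ (hpos U hU).ne').symm, fun S _ => ?_⟩, ?_⟩
  · rcases S.eq_empty_or_nonempty with rfl | hS
    · simp [adjCount]
    · exact hle S hS
  · exact hle Finset.univ Finset.univ_nonempty

/-- Small subsets of a densest set have large edge boundary. -/
lemma IsDensest.le_two_mul_cut [DecidableEq V] {G : SimpleGraph V} {U : Finset V} {ρ : ℝ}
    (h : IsDensest G U ρ) (hρ : 0 ≤ ρ) {S : Finset V} (hS : S ⊆ U) {k : ℕ}
    (hk : S.card * 2 ^ k ≤ U.card) :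
    ρ * (S.card * k) ≤ 2 * adjCount G S (U \ S) := by
  rcases S.eq_empty_or_nonempty with rfl | hne
  · simp
  have h1 := h.le S hS
  have h2 := h.le (U \ S) Finset.sdiff_subset
  have h3 : (adjCount G U U : ℝ) =
      adjCount G S S + 2 * adjCount G S (U \ S) + adjCount G (U \ S) (U \ S) := by
    exact_mod_cast adjCount_self_eq G hS
  have h4 : ((U \ S).card : ℝ) = U.card - S.card := by
    rw [Finset.card_sdiff_of_subset hS, Nat.cast_sub (Finset.card_le_card hS)]
  have h5 : (logWeight (U \ S).card : ℝ) ≤ logWeight U.card := by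
    exact_mod_cast logWeight_mono (Finset.card_le_card Finset.sdiff_subset)
  have h6 : (logWeight S.card + k : ℝ) ≤ logWeight U.card := by
    exact_mod_cast logWeight_add_le hne.card_pos.ne' hk
  have h7 : ((U \ S).card : ℝ) * logWeight (U \ S).card ≤
      (U.card - S.card) * logWeight U.card := by
    rw [← h4]; gcongr
  have h8 : (S.card : ℝ) * (logWeight S.card + k) ≤ S.card * logWeight U.card := by gcongr
  -- The two parts together fall short of the density bound for `U` by at least `ρ * S.card * k`,
  -- because `logWeight S.card` is smaller than `logWeight U.card` by `k`; the cut must supply this.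
  have h9 : ρ * (S.card * k) ≤ ρ * (U.card * logWeight U.card - S.card * logWeight S.card -
      (U \ S).card * logWeight (U \ S).card) := by
    refine mul_le_mul_of_nonneg_left ?_ hρ
    linarith
  have h10 := h.eq
  linarith

/-- The number of steps in which balls around robust vertices grow beyond half of their cluster. -/
def growthTime (l : ℕ) : ℕ := ∑ k ∈ Finset.Icc 1 l, (8 * l / k + 1)

/-- Here `s` stands for ball sizes and `a` for adjacencies inside the balls. While `s` lies between
`u / 2 ^ (k + 1)` and `u / 2 ^ k`, each step adds `ρ / 4 * s * k` to `a`, which never exceeds `ρ * s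
* l`; as `s` less than doubles in this phase, it lasts at most `8 * l / k` steps. Summing over `k`
gives a harmonic sum. -/
lemma exists_growth {s : ℕ → ℕ} {a : ℕ → ℝ} {ρ : ℝ} {u l : ℕ} (hρ : 0 < ρ) (hs : Monotone s)
    (hs0 : 0 < s 0) (hu : u < 2 ^ l)
    (ha0 : ∀ r, 0 ≤ a r) (hal : ∀ r, a r ≤ ρ * (s r * l))
    (hstep : ∀ r k : ℕ, 1 ≤ k → s r * 2 ^ k ≤ u → a r + ρ / 4 * (s r * k) ≤ a (r + 1)) :
    u < 2 * s (growthTime l) := by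
  have key : ∀ j, j < l →
      u < s (∑ k ∈ Finset.Icc (l - j) l, (8 * l / k + 1)) * 2 ^ (l - j) := by
    have phase : ∀ k r : ℕ, 1 ≤ k → u < s r * 2 ^ (k + 1) → u < s (r + (8 * l / k + 1)) * 2 ^ k := by
      intro k r hk hr
      by_contra hcon
      push Not at hcon
      have hlow : ∀ t, t ≤ 8 * l / k + 1 → t * (ρ / 4 * (s r * k)) ≤ a (r + t) := by
        intro t
        induction t with
        | zero => intro _; simpa using ha0 r
        | succ t ih =>
          intro ht
          have h1 := ih (by omega)
          have h2 := hstep (r + t) k hk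
            (le_trans (Nat.mul_le_mul_right _ (hs (by omega))) hcon)
          have h3 : (s r : ℝ) ≤ s (r + t) := by exact_mod_cast hs (by omega)
          have h4 : ρ / 4 * (s r * k) ≤ ρ / 4 * (s (r + t) * k) := by gcongr
          rw [← add_assoc]
          push_cast
          linarith
      -- One step more than `8 * l / k` makes the accumulated gain exceed the capacity `2 * ρ * s r
      -- * l`.
      have h1 := hlow _ le_rfl
      have h2 := hal (r + (8 * l / k + 1))
      have h3 : s (r + (8 * l / k + 1)) < 2 * s r := by
        have : s (r + (8 * l / k + 1)) * 2 ^ k < (2 * s r) * 2 ^ k := by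
          rw [pow_succ] at hr
          linarith
        exact lt_of_mul_lt_mul_right this (by positivity)
      have hsr : 0 < s r := lt_of_lt_of_le hs0 (hs (by omega))
      have h4 : 8 * l < (8 * l / k + 1) * k := by
        have := Nat.div_add_mod (8 * l) k
        have := Nat.mod_lt (8 * l) (show 0 < k by omega)
        nlinarith
      have h5 : ρ * (s (r + (8 * l / k + 1)) * l) ≤ ρ * (2 * s r * l) := by
        have : (s (r + (8 * l / k + 1)) : ℝ) ≤ 2 * s r := by exact_mod_cast h3.le
        gcongr
      have h6 : ((8 * l : ℕ) : ℝ) < ((8 * l / k + 1) * k : ℕ) := by exact_mod_cast h4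
      have h7 : 0 < ρ * s r := by positivity
      push_cast at h1 h6
      nlinarith
    intro j
    induction j with
    | zero =>
      intro _
      refine hu.trans_le ?_
      have : 1 ≤ s (∑ k ∈ Finset.Icc (l - 0) l, (8 * l / k + 1)) :=
        lt_of_lt_of_le hs0 (hs (by omega))
      simpa using Nat.le_mul_of_pos_left (2 ^ l) this
    | succ j ih =>
      intro hj
      have h1 := ih (by omega)
      have h2 := phase (l - (j + 1)) _ (by omega)
        (by rwa [show l - (j + 1) + 1 = l - j by omega])
      have h3 : Finset.Icc (l - (j + 1)) l = insert (l - (j + 1)) (Finset.Icc (l - j) l) := by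
        ext x; simp only [Finset.mem_Icc, Finset.mem_insert]; omega
      rw [h3, Finset.sum_insert (by simp only [Finset.mem_Icc]; omega), add_comm]
      exact h2
  rcases Nat.eq_zero_or_pos l with rfl | hl
  · have := lt_of_lt_of_le hs0 (hs (Nat.zero_le (growthTime 0)))
    omega
  · have := key (l - 1) (by omega)
    rw [show l - (l - 1) = 1 by omega] at this
    unfold growthTime
    omega

/-- The neighbourhood of a vertex, as a finset. -/
noncomputable def nbr [Fintype V] (G : SimpleGraph V) (x : V) : Finset V :=
  open Classical in Finset.univ.filter (G.Adj x)

@[simp]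
lemma mem_nbr [Fintype V] {G : SimpleGraph V} {x y : V} : y ∈ nbr G x ↔ G.Adj x y := by
  simp [nbr]

/-- The ball of radius `r` around `x`. -/
noncomputable def walkBall [Fintype V] (G : SimpleGraph V) (x : V) (r : ℕ) : Finset V :=
  open Classical in Finset.univ.filter fun y => ∃ p : G.Walk x y, p.length ≤ r

@[simp]
lemma mem_walkBall [Fintype V] {G : SimpleGraph V} {x y : V} {r : ℕ} :
    y ∈ walkBall G x r ↔ ∃ p : G.Walk x y, p.length ≤ r := by
  simp [walkBall]

lemma walkBall_mono [Fintype V] (G : SimpleGraph V) (x : V) : Monotone (walkBall G x) := by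
  intro r r' h y hy
  obtain ⟨p, hp⟩ := mem_walkBall.1 hy
  exact mem_walkBall.2 ⟨p, hp.trans h⟩

lemma nbr_subset_walkBall [Fintype V] {G : SimpleGraph V} {x y : V} {r : ℕ}
    (hy : y ∈ walkBall G x r) : nbr G y ⊆ walkBall G x (r + 1) := by
  intro z hz
  obtain ⟨p, hp⟩ := mem_walkBall.1 hy
  refine mem_walkBall.2 ⟨p.concat (mem_nbr.1 hz), ?_⟩
  rw [SimpleGraph.Walk.length_concat]
  omega

lemma walkBall_subset [Fintype V] {G : SimpleGraph V} {U : Finset V}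
    (hG : ∀ x y, G.Adj x y → x ∈ U) {x : V} (hx : x ∈ U) (r : ℕ) : walkBall G x r ⊆ U := by
  intro y hy
  obtain ⟨p, -⟩ := mem_walkBall.1 hy
  clear hy
  induction p with
  | nil => exact hx
  | cons h p ih => exact ih (hG _ _ h.symm)

lemma IsDensest.lt_two_mul_card_walkBall [Fintype V] {G : SimpleGraph V} {U : Finset V} {ρ : ℝ}
    (h : IsDensest G U ρ) (hρ : 0 < ρ) (hG : ∀ x y, G.Adj x y → x ∈ U) {l : ℕ}
    (hl : logWeight U.card ≤ l) {D : Finset (Sym2 V)} {K : ℕ} (hK : 0 < K)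
    (hDK : 4 * (D.card : ℝ) ≤ ρ * K) {x : V} (hx : K ≤ (nbr (G.deleteEdges D) x).card) :
    U.card < 2 * (walkBall (G.deleteEdges D) x (growthTime l + 1)).card := by
  classical
  set H := G.deleteEdges (D : Set (Sym2 V)) with hH
  have hHG : H ≤ G := SimpleGraph.deleteEdges_le _
  have hxU : x ∈ U := by
    obtain ⟨y, hy⟩ := Finset.card_pos.1 (hK.trans_le hx)
    exact hG x y (hHG (mem_nbr.1 hy))
  have hBU : ∀ r, walkBall H x r ⊆ U := walkBall_subset (fun a b hab => hG a b (hHG hab)) hxU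
  have hself : x ∈ walkBall H x 0 := mem_walkBall.2 ⟨.nil, by simp⟩
  have hKB : ∀ r, K ≤ (walkBall H x (r + 1)).card := fun r =>
    hx.trans (Finset.card_le_card ((nbr_subset_walkBall hself).trans
      (walkBall_mono H x (by omega))))
  -- Radii are shifted by one so that every ball contains the neighbourhood of `x`, hence at least
  -- `K` vertices.
  refine exists_growth (s := fun r => (walkBall H x (r + 1)).card)
    (a := fun r => adjCount H (walkBall H x (r + 1)) (walkBall H x (r + 1))) hρ
    (fun r r' hr => Finset.card_le_card (walkBall_mono H x (by omega))) (hK.trans_le (hKB 0))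
    ((Nat.lt_pow_succ_log_self (by norm_num) _).trans_le
      (Nat.pow_le_pow_right (by norm_num) hl)) (fun r => Nat.cast_nonneg _) ?_ ?_
  · intro r
    have h1 := h.le _ (hBU (r + 1))
    have h2 : (adjCount H (walkBall H x (r + 1)) (walkBall H x (r + 1)) : ℝ) ≤
        adjCount G (walkBall H x (r + 1)) (walkBall H x (r + 1)) := by
      exact_mod_cast adjCount_mono hHG subset_rfl subset_rfl
    have h3 : (logWeight (walkBall H x (r + 1)).card : ℝ) ≤ l := by
      exact_mod_cast (logWeight_mono (Finset.card_le_card (hBU (r + 1)))).trans hl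
    refine (h2.trans h1).trans ?_
    gcongr
  · intro r k hk hrk
    set B := walkBall H x (r + 1) with hB
    have h1 := h.le_two_mul_cut hρ.le (hBU (r + 1)) hrk
    have h2 : (adjCount G B (U \ B) : ℝ) ≤ adjCount H B (U \ B) + D.card := by
      exact_mod_cast adjCount_le_deleteEdges_add_card G D Finset.disjoint_sdiff
    have h3 : adjCount H B B + adjCount H B (U \ B) = adjCount H B U :=
      adjCount_add_sdiff_right H B (hBU (r + 1))
    have h4 : adjCount H B U ≤
        adjCount H (walkBall H x (r + 1 + 1)) (walkBall H x (r + 1 + 1)) := by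
      refine le_trans ?_ (adjCount_mono le_rfl (walkBall_mono H x (Nat.le_succ (r + 1)))
        subset_rfl)
      unfold adjCount
      refine Finset.sum_le_sum fun y hy => ?_
      refine Finset.sum_le_sum_of_ne_zero fun z _ hz => nbr_subset_walkBall hy (mem_nbr.2 ?_)
      by_contra hyz
      simp [hyz] at hz
    have h5 : (adjCount H B B : ℝ) + adjCount H B (U \ B) ≤
        adjCount H (walkBall H x (r + 1 + 1)) (walkBall H x (r + 1 + 1)) := by
      exact_mod_cast h3.le.trans h4
    -- The deletions cost at most `ρ * K / 4`, half of the guaranteed cut `ρ * B.card * k / 2`.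
    have h6 : ρ * K ≤ ρ * (B.card * k) := by
      refine mul_le_mul_of_nonneg_left ?_ hρ.le
      exact_mod_cast (hKB r).trans (Nat.le_mul_of_pos_right _ hk)
    linarith

/-- Vertices of a densest set that keep enough edges after a deletion stay close to each other. -/
lemma IsDensest.exists_walk [Fintype V] {G : SimpleGraph V} {U : Finset V} {ρ : ℝ}
    (h : IsDensest G U ρ) (hρ : 0 < ρ) (hG : ∀ x y, G.Adj x y → x ∈ U) {l : ℕ}
    (hl : logWeight U.card ≤ l) {D : Finset (Sym2 V)} {K : ℕ} (hK : 0 < K)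
    (hDK : 4 * (D.card : ℝ) ≤ ρ * K) {x y : V} (hx : K ≤ (nbr (G.deleteEdges D) x).card)
    (hy : K ≤ (nbr (G.deleteEdges D) y).card) :
    ∃ p : (G.deleteEdges (D : Set (Sym2 V))).Walk x y, p.length ≤ 2 * growthTime l + 2 := by
  classical
  have h1 := h.lt_two_mul_card_walkBall hρ hG hl hK hDK hx
  have h2 := h.lt_two_mul_card_walkBall hρ hG hl hK hDK hy
  have hsub : ∀ z, K ≤ (nbr (G.deleteEdges D) z).card →
      walkBall (G.deleteEdges (D : Set (Sym2 V))) z (growthTime l + 1) ⊆ U := by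
    intro z hz
    obtain ⟨w, hw⟩ := Finset.card_pos.1 (hK.trans_le hz)
    have hle := SimpleGraph.deleteEdges_le (G := G) (D : Set (Sym2 V))
    exact walkBall_subset (fun a b hab => hG a b (hle hab)) (hG z w (hle (mem_nbr.1 hw))) _
  -- Both balls lie in `U` and contain more than half of it.
  have h3 : ¬ Disjoint (walkBall (G.deleteEdges (D : Set (Sym2 V))) x (growthTime l + 1))
      (walkBall (G.deleteEdges (D : Set (Sym2 V))) y (growthTime l + 1)) := by
    intro hd
    have := Finset.card_le_card (Finset.union_subset (hsub x hx) (hsub y hy))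
    rw [Finset.card_union_of_disjoint hd] at this
    omega
  obtain ⟨z, hz, hz'⟩ := Finset.not_disjoint_iff.1 h3
  obtain ⟨p, hp⟩ := mem_walkBall.1 hz
  obtain ⟨p', hp'⟩ := mem_walkBall.1 hz'
  refine ⟨p.append p'.reverse, ?_⟩
  rw [SimpleGraph.Walk.length_append, SimpleGraph.Walk.length_reverse]
  omega

end Expansion

/-! ### Greedy decomposition into dense clusters -/

section Decomposition

variable {V : Type*}

/-- The pair `x, y` lies in the cluster `U i` and in no earlier one. -/
def InLayer (U : ℕ → Finset V) (i : ℕ) (x y : V) : Prop :=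
  (x ∈ U i ∧ y ∈ U i) ∧ ∀ j < i, ¬ (x ∈ U j ∧ y ∈ U j)

lemma InLayer.symm {U : ℕ → Finset V} {i : ℕ} {x y : V} (h : InLayer U i x y) :
    InLayer U i y x :=
  ⟨h.1.symm, fun j hj hc => h.2 j hj hc.symm⟩

/-- The edges of `G` whose first cluster is `U i`. -/
def layer (G : SimpleGraph V) (U : ℕ → Finset V) (i : ℕ) : SimpleGraph V where
  Adj x y := G.Adj x y ∧ InLayer U i x y
  symm := ⟨fun _ _ h => ⟨h.1.symm, h.2.symm⟩⟩
  loopless := ⟨fun _ h => G.irrefl h.1⟩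

/-- The edges of `G` that lie in no cluster. -/
def uncovered (G : SimpleGraph V) (U : ℕ → Finset V) : SimpleGraph V where
  Adj x y := G.Adj x y ∧ ∀ i, ¬ (x ∈ U i ∧ y ∈ U i)
  symm := ⟨fun _ _ h => ⟨h.1.symm, fun i hc => h.2 i hc.symm⟩⟩
  loopless := ⟨fun _ h => G.irrefl h.1⟩

lemma uncovered_le (G : SimpleGraph V) (U : ℕ → Finset V) : uncovered G U ≤ G :=
  fun _ _ h => h.1

lemma uncovered_or_layer {G : SimpleGraph V} (U : ℕ → Finset V) {x y : V} (h : G.Adj x y) :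
    (uncovered G U).Adj x y ∨ ∃ i, (layer G U i).Adj x y := by
  classical
  by_cases hex : ∃ i, x ∈ U i ∧ y ∈ U i
  · exact .inr ⟨Nat.find hex, h, Nat.find_spec hex, fun j hj => Nat.find_min hex hj⟩
  · exact .inl ⟨h, not_exists.1 hex⟩

/-- The edges of `G` that do not lie inside `A`. -/
def removeInside (G : SimpleGraph V) (A : Finset V) : SimpleGraph V where
  Adj x y := G.Adj x y ∧ ¬ (x ∈ A ∧ y ∈ A)
  symm := ⟨fun _ _ h => ⟨h.1.symm, fun hc => h.2 hc.symm⟩⟩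
  loopless := ⟨fun _ h => G.irrefl h.1⟩

lemma removeInside_adj {G : SimpleGraph V} {A : Finset V} {x y : V} :
    (removeInside G A).Adj x y ↔ G.Adj x y ∧ ¬ (x ∈ A ∧ y ∈ A) :=
  Iff.rfl

/-- The sequence `A, U 0, U 1, …`. -/
def consSeq (A : Finset V) (U : ℕ → Finset V) : ℕ → Finset V
  | 0 => A
  | i + 1 => U i

lemma layer_consSeq_zero_adj {G : SimpleGraph V} {A : Finset V} {U : ℕ → Finset V} {x y : V} :
    (layer G (consSeq A U) 0).Adj x y ↔ G.Adj x y ∧ x ∈ A ∧ y ∈ A := by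
  simp [layer, InLayer, consSeq]

lemma layer_consSeq_succ (G : SimpleGraph V) (A : Finset V) (U : ℕ → Finset V) (i : ℕ) :
    layer G (consSeq A U) (i + 1) = layer (removeInside G A) U i := by
  ext x y
  simp only [layer, InLayer, removeInside, consSeq]
  constructor
  · rintro ⟨h, h1, h2⟩
    exact ⟨⟨h, h2 0 (by omega)⟩, h1, fun j hj => h2 (j + 1) (by omega)⟩
  · rintro ⟨⟨h, h0⟩, h1, h2⟩
    refine ⟨h, h1, fun j hj => ?_⟩
    cases j with
    | zero => exact h0
    | succ j => exact h2 j (by omega)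

lemma uncovered_consSeq (G : SimpleGraph V) (A : Finset V) (U : ℕ → Finset V) :
    uncovered G (consSeq A U) = uncovered (removeInside G A) U := by
  ext x y
  simp only [uncovered, removeInside]
  constructor
  · rintro ⟨h, h2⟩
    exact ⟨⟨h, h2 0⟩, fun j => h2 (j + 1)⟩
  · rintro ⟨⟨h, h0⟩, h2⟩
    refine ⟨h, fun j => ?_⟩
    cases j with
    | zero => exact h0
    | succ j => exact h2 j

variable [Fintype V]

lemma adjCount_removeInside (G : SimpleGraph V) (A : Finset V) :
    adjCount (removeInside G A) Finset.univ Finset.univ + adjCount G A A =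
      adjCount G Finset.univ Finset.univ := by
  classical
  rw [adjCount_eq_card, adjCount_eq_card, adjCount_eq_card,
    ← Finset.card_union_of_disjoint]
  · congr 1
    ext p
    simp only [Finset.mem_union, Finset.mem_filter, Finset.mem_product, Finset.mem_univ,
      true_and]
    rw [removeInside_adj]
    tauto
  · rw [Finset.disjoint_left]
    intro p hp hp'
    simp only [Finset.mem_filter, Finset.mem_product] at hp hp'
    exact hp.2.2 hp'.1

/-- Each of the `e` terms of the difference is at least `1 / (m + e)`. This turns the relative loss
of edges in one removal into a telescoping bound. -/
lemma div_le_harmonic_sub (m e : ℕ) :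
    (e : ℝ) / (m + e : ℕ) ≤ (harmonic (m + e) : ℝ) - harmonic m := by
  induction e with
  | zero => simp
  | succ e ih =>
    rw [← add_assoc, harmonic_succ]
    push_cast at ih ⊢
    have h1 : (e : ℝ) / (m + e + 1) ≤ e / (m + e) := by
      rcases Nat.eq_zero_or_pos e with rfl | he
      · simp
      · have : (0 : ℝ) < e := by exact_mod_cast he
        exact div_le_div_of_nonneg_left this.le (by positivity) (by linarith)
    rw [add_div, one_div]
    linarith

/-- Repeatedly removing a densest cluster leaves few edges, and the clusters are small in total. -/
lemma exists_clusters [Nonempty V] (q m : ℕ) (hq : 0 < q) : ∀ G : SimpleGraph V,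
    adjCount G Finset.univ Finset.univ = m →
    ∃ U : ℕ → Finset V, (∀ i, m ≤ i → U i = ∅) ∧
      (∀ k, (∑ i ∈ Finset.range k, ((U i).card : ℝ)) ≤
        Fintype.card V * logWeight (Fintype.card V) * harmonic m) ∧
      adjCount (uncovered G U) Finset.univ Finset.univ ≤
        q * (Fintype.card V * logWeight (Fintype.card V)) ∧
      ∀ i, (U i).Nonempty → ∃ ρ : ℝ, q ≤ ρ ∧ IsDensest (layer G U i) (U i) ρ := by
  induction m using Nat.strong_induction_on with
  | _ m ih =>
  intro G hG
  set N := Fintype.card V * logWeight (Fintype.card V) with hN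
  have hNpos : 0 < N := Nat.mul_pos Fintype.card_pos (Nat.succ_pos _)
  -- Above this threshold the densest cluster has density at least `q`; below it the remaining edges
  -- are few enough to be stored.
  by_cases hm : m ≤ q * N
  · refine ⟨fun _ => ∅, fun _ _ => rfl, fun k => ?_, ?_, fun i hi => ?_⟩
    · have : (0 : ℝ) ≤ harmonic m := by
        exact_mod_cast (Finset.sum_nonneg fun i _ => by positivity : (0 : ℚ) ≤ harmonic m)
      simp only [Finset.card_empty, Nat.cast_zero, Finset.sum_const_zero]
      positivity
    · refine le_trans (adjCount_mono (uncovered_le G _) subset_rfl subset_rfl) (hG.le.trans hm)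
    · exact absurd hi (by simp)
  · push Not at hm
    obtain ⟨A, ρ, hA, hAρ, hmρ⟩ := exists_isDensest G
    have hmN : (m : ℝ) ≤ ρ * N := by rw [← hG, hN]; push_cast; exact hmρ
    have hqρ : (q : ℝ) ≤ ρ := by
      have h1 : (q * N : ℝ) < m := by exact_mod_cast hm
      have h2 : (0 : ℝ) < N := by exact_mod_cast hNpos
      exact le_of_mul_le_mul_right (h1.le.trans hmN) h2
    have hρ : 0 < ρ := lt_of_lt_of_le (by exact_mod_cast hq) hqρ
    have hAcard : ρ * A.card ≤ adjCount G A A := by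
      rw [hAρ.eq]
      have : (1 : ℝ) ≤ logWeight A.card := by exact_mod_cast Nat.succ_pos _
      have h0 : (0 : ℝ) ≤ A.card := Nat.cast_nonneg _
      refine mul_le_mul_of_nonneg_left ?_ hρ.le
      nlinarith
    set e := adjCount G A A with he
    set m' := adjCount (removeInside G A) Finset.univ Finset.univ with hm'
    have hsum : m' + e = m := by rw [← hG]; exact adjCount_removeInside G A
    have hepos : 0 < e := by
      have h1 : (0 : ℝ) < ρ * A.card := mul_pos hρ (by exact_mod_cast hA.card_pos)
      exact_mod_cast h1.trans_le hAcard
    obtain ⟨U, hU0, hUsum, hUunc, hUd⟩ := ih m' (by omega) (removeInside G A) rfl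
    refine ⟨consSeq A U, ?_, ?_, ?_, ?_⟩
    · intro i hi
      cases i with
      | zero => omega
      | succ i => exact hU0 i (by omega)
    -- From `ρ * A.card ≤ e` and `m ≤ ρ * N` follows `A.card ≤ N * (e / m)`.
    · have hstep : (A.card : ℝ) + Fintype.card V * logWeight (Fintype.card V) * harmonic m' ≤
          Fintype.card V * logWeight (Fintype.card V) * harmonic m := by
        have h1 := div_le_harmonic_sub m' e
        rw [hsum] at h1
        have hm0 : (0 : ℝ) < m := by exact_mod_cast (by omega : 0 < m)
        have h2 : (A.card : ℝ) ≤ N * (e / m) := by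
          rw [← mul_div_assoc, le_div_iff₀ hm0]
          have h3 : (A.card : ℝ) * m ≤ A.card * (ρ * N) := by gcongr
          have h4 : ρ * A.card * N ≤ e * N := by gcongr
          linarith
        have h5 : (N : ℝ) * (e / m) ≤ N * (harmonic m - harmonic m') := by gcongr
        have h6 : (N : ℝ) = Fintype.card V * logWeight (Fintype.card V) := by
          rw [hN]; push_cast; rfl
        rw [← h6]
        linarith
      intro k
      cases k with
      | zero =>
        have h1 := hUsum 0
        simp only [Finset.range_zero, Finset.sum_empty] at h1 ⊢
        have h2 : (0 : ℝ) ≤ A.card := Nat.cast_nonneg _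
        linarith
      | succ k =>
        rw [Finset.sum_range_succ']
        have h1 := hUsum k
        simp only [consSeq]
        linarith
    · rwa [uncovered_consSeq]
    · intro i hi
      cases i with
      | zero =>
        refine ⟨ρ, hqρ, hAρ.congr fun x hx y hy => ?_⟩
        rw [layer_consSeq_zero_adj]
        exact ⟨fun h => ⟨h, hx, hy⟩, fun h => h.1⟩
      | succ i =>
        rw [layer_consSeq_succ]
        exact hUd i hi

end Decomposition

/-! ### Counting small sets and colouring nearby sets -/

section Counting

lemma card_finset_card_le {Q : Type*} [Fintype Q] (N : ℕ) :
    Nat.card {T : Finset Q // T.card ≤ N} ≤ (Fintype.card Q + 1) ^ N := by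
  classical
  -- A set is coded by its list of elements, padded with `none` to length `N`.
  have hinj : Function.Injective fun (T : {T : Finset Q // T.card ≤ N}) (i : Fin N) =>
      T.1.toList[(i : ℕ)]? := by
    have key : ∀ T : {T : Finset Q // T.card ≤ N}, ∀ a,
        a ∈ T.1 ↔ ∃ i : Fin N, T.1.toList[(i : ℕ)]? = some a := by
      intro T a
      rw [← Finset.mem_toList, List.mem_iff_getElem?]
      constructor
      · rintro ⟨i, hi⟩
        obtain ⟨h, -⟩ := List.getElem?_eq_some_iff.1 hi
        rw [Finset.length_toList] at h
        exact ⟨⟨i, h.trans_le T.2⟩, hi⟩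
      · rintro ⟨i, hi⟩
        exact ⟨i, hi⟩
    intro T T' h
    refine Subtype.ext (Finset.ext fun a => ?_)
    rw [key, key]
    exact exists_congr fun i => by rw [show T.1.toList[(i : ℕ)]? = _ from congrFun h i]
  have := Nat.card_le_card_of_injective _ hinj
  simpa [Nat.card_eq_fintype_card] using this

/-- Greedy colouring: fewer than `Δ` conflicting elements always leave a free colour. -/
lemma exists_coloring {α : Type*} [Fintype α] (r : α → α → Prop) (hr : ∀ a b, r a b → r b a)
    (Δ : ℕ) (h : ∀ a, Nat.card {b // b ≠ a ∧ r a b} < Δ) :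
    ∃ c : α → Fin Δ, ∀ a b, a ≠ b → r a b → c a ≠ c b := by
  classical
  suffices H : ∀ S : Finset α, ∃ c : α → Fin Δ, ∀ a ∈ S, ∀ b ∈ S, a ≠ b → r a b → c a ≠ c b by
    obtain ⟨c, hc⟩ := H Finset.univ
    exact ⟨c, fun a b => hc a (Finset.mem_univ a) b (Finset.mem_univ b)⟩
  intro S
  induction S using Finset.induction_on with
  | empty =>
    rcases isEmpty_or_nonempty α with hα | ⟨⟨a⟩⟩
    · exact ⟨fun a => (hα.false a).elim, by simp⟩
    · exact ⟨fun _ => ⟨0, (Nat.zero_le _).trans_lt (h a)⟩, by simp⟩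
  | insert a S ha ih =>
    obtain ⟨c, hc⟩ := ih
    obtain ⟨k, hk⟩ : ∃ k, k ∉ (Finset.univ.filter fun b => b ≠ a ∧ r a b).image c := by
      by_contra hcon
      push Not at hcon
      have h1 : Δ ≤ ((Finset.univ.filter fun b => b ≠ a ∧ r a b).image c).card := by
        rw [Finset.eq_univ_iff_forall.2 hcon, Finset.card_univ, Fintype.card_fin]
      have h2 := h a
      rw [Nat.card_eq_fintype_card, Fintype.card_subtype] at h2
      exact absurd (h1.trans Finset.card_image_le) (not_le.2 h2)
    have hk' : ∀ b, b ≠ a → r a b → c b ≠ k := fun b hb hab hcb =>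
      hk (Finset.mem_image.2 ⟨b, by simp [hb, hab], hcb⟩)
    refine ⟨Function.update c a k, fun x hx y hy hxy hrxy => ?_⟩
    by_cases hxa : x = a
    · subst hxa
      rw [Function.update_self, Function.update_of_ne hxy.symm]
      exact (hk' y hxy.symm hrxy).symm
    · by_cases hya : y = a
      · subst hya
        rw [Function.update_self, Function.update_of_ne hxa]
        exact hk' x hxa (hr _ _ hrxy)
      · rw [Function.update_of_ne hxa, Function.update_of_ne hya]
        exact hc x (Finset.mem_of_mem_insert_of_ne hx hxa) y
          (Finset.mem_of_mem_insert_of_ne hy hya) hxy hrxy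

/-- Finsets can be coloured with few colours so that close ones get different colours. -/
lemma exists_finset_coloring (V : Type*) [Fintype V] [DecidableEq V] (d : ℕ) :
    ∃ c : Finset V → Fin ((Fintype.card V + 1) ^ d),
      ∀ A B, (symmDiff A B).card ≤ d → c A = c B → A = B := by
  obtain ⟨c, hc⟩ := exists_coloring (fun A B : Finset V => (symmDiff A B).card ≤ d)
    (fun A B h => by rwa [symmDiff_comm]) ((Fintype.card V + 1) ^ d) (fun A => by
      refine lt_of_lt_of_le ?_ (card_finset_card_le (Q := V) d)
      rw [Nat.card_eq_fintype_card, Nat.card_eq_fintype_card]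
      -- The strict inequality comes from `∅`, which is not the symmetric difference of two distinct
      -- sets.
      refine Fintype.card_lt_of_injective_of_notMem
        (fun B => (⟨symmDiff A B.1, B.2.2⟩ : {T : Finset V // T.card ≤ d})) ?_
        (b := ⟨∅, by simp⟩) ?_
      · intro B B' h
        exact Subtype.ext (symmDiff_right_injective A (Subtype.ext_iff.1 h))
      · rintro ⟨B, hB⟩
        have h2 : symmDiff A B.1 = ∅ := Subtype.ext_iff.1 hB
        exact B.2.1 (symmDiff_eq_bot.1 h2).symm)
  exact ⟨c, fun A B h hcol => by_contra fun hne => hc A B hne h hcol⟩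

end Counting

/-! ### Recovering surviving adjacencies from the sketch -/

section Sketch

variable {V : Type*} [Fintype V]

lemma nbr_deleteEdges [DecidableEq V] (G : SimpleGraph V) (D : Finset (Sym2 V)) (x : V) :
    nbr (G.deleteEdges D) x = nbr G x \ Finset.univ.filter (fun y => s(x, y) ∈ D) := by
  ext y
  simp

/-- Within one cluster, colours and degrees of neighbourhoods determine all surviving edges up to
short detours. -/
lemma IsDensest.exists_walk_of_color_eq [DecidableEq V] {L L' : SimpleGraph V} {A : Finset V}
    {ρ : ℝ} (h : IsDensest L' A ρ) (hρ : 0 < ρ) (hL' : ∀ x y, L'.Adj x y → x ∈ A) {l : ℕ}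
    (hl : logWeight A.card ≤ l) {K : ℕ} (hK : 0 < K) {ι : Type*} (c : Finset V → ι)
    (hc : ∀ A B, (symmDiff A B).card ≤ 2 * K → c A = c B → A = B)
    {D : Finset (Sym2 V)} (hDK : 4 * (D.card : ℝ) ≤ ρ * K)
    (hD : (D : Set (Sym2 V)) ⊆ L.edgeSet) (hD' : (D : Set (Sym2 V)) ⊆ L'.edgeSet) {x y : V}
    (hx : c (nbr L x) = c (nbr L' x)) (hx' : (nbr L x).card = (nbr L' x).card)
    (hy : c (nbr L y) = c (nbr L' y)) (hy' : (nbr L y).card = (nbr L' y).card)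
    (hxy : L.Adj x y) (hxyD : s(x, y) ∉ D) :
    ∃ p : (L'.deleteEdges (D : Set (Sym2 V))).Walk x y, p.length ≤ 2 * growthTime l + 2 := by
  -- The deletions are edges of both graphs, so equal degrees stay equal.
  have hcard : ∀ z, (nbr L z).card = (nbr L' z).card →
      (nbr (L.deleteEdges D) z).card = (nbr (L'.deleteEdges D) z).card := by
    intro z hz
    rw [nbr_deleteEdges, nbr_deleteEdges, Finset.card_sdiff_of_subset,
      Finset.card_sdiff_of_subset, hz]
    · intro w hw
      exact mem_nbr.2 (hD' (Finset.mem_filter.1 hw).2)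
    · intro w hw
      exact mem_nbr.2 (hD (Finset.mem_filter.1 hw).2)
  have hlow : ∀ z, c (nbr L z) = c (nbr L' z) → (nbr L z).card = (nbr L' z).card →
      (nbr (L'.deleteEdges D) z).card < K → nbr L z = nbr L' z := by
    intro z hcz hz hlt
    refine hc _ _ ?_ hcz
    have hlt' := (hcard z hz).trans_lt hlt
    -- A neighbour in only one graph cannot have been deleted, so it is among the fewer than `K`
    -- survivors on its side.
    have hsub : symmDiff (nbr L z) (nbr L' z) ⊆
        nbr (L.deleteEdges D) z ∪ nbr (L'.deleteEdges D) z := by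
      intro w hw
      rw [Finset.mem_symmDiff, mem_nbr, mem_nbr] at hw
      rw [Finset.mem_union, mem_nbr, mem_nbr, SimpleGraph.deleteEdges_adj,
        SimpleGraph.deleteEdges_adj]
      rcases hw with ⟨h1, h2⟩ | ⟨h1, h2⟩
      · exact .inl ⟨h1, fun hm => h2 (hD' hm)⟩
      · exact .inr ⟨h1, fun hm => h2 (hD hm)⟩
    have := (Finset.card_le_card hsub).trans (Finset.card_union_le _ _)
    omega
  have hedge : L'.Adj x y → ∃ p : (L'.deleteEdges (D : Set (Sym2 V))).Walk x y,
      p.length ≤ 2 * growthTime l + 2 := by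
    intro hadj
    exact ⟨.cons (SimpleGraph.deleteEdges_adj.2 ⟨hadj, hxyD⟩) .nil, by simp⟩
  by_cases hkx : (nbr (L'.deleteEdges (D : Set (Sym2 V))) x).card < K
  · refine hedge (mem_nbr.1 ?_)
    rw [← hlow x hx hx' hkx]
    exact mem_nbr.2 hxy
  by_cases hky : (nbr (L'.deleteEdges (D : Set (Sym2 V))) y).card < K
  · refine hedge (mem_nbr.1 ?_).symm
    rw [← hlow y hy hy' hky]
    exact mem_nbr.2 hxy.symm
  exact h.exists_walk hρ hL' hl hK hDK (not_lt.1 hkx) (not_lt.1 hky)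

/-- For every vertex of every cluster, the colour and the size of its neighbourhood there. -/
noncomputable def clusterSketch {ι : Type*} (c : Finset V → ι) (M : ℕ) (U : ℕ → Finset V)
    (G : SimpleGraph V) : Finset (Fin M × V × ι × Fin (Fintype.card V + 1)) :=
  open Classical in
  ((Finset.univ : Finset (Fin M)).sigma fun i => U i).image fun t =>
    (t.1, t.2, c (nbr (layer G U t.1) t.2),
      ⟨(nbr (layer G U t.1) t.2).card, Nat.lt_succ_of_le (Finset.card_le_univ _)⟩)

lemma card_clusterSketch_le {ι : Type*} (c : Finset V → ι) (M : ℕ) (U : ℕ → Finset V)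
    (G : SimpleGraph V) :
    (clusterSketch c M U G).card ≤ ∑ i ∈ Finset.range M, (U i).card := by
  classical
  refine Finset.card_image_le.trans ?_
  rw [Finset.card_sigma, Finset.sum_range]

lemma clusterSketch_subset {ι : Type*} {c : Finset V → ι} {M : ℕ} {U U' : ℕ → Finset V}
    {G G' : SimpleGraph V} (h : clusterSketch c M U G = clusterSketch c M U' G') {i : ℕ}
    (hi : i < M) {x : V} (hx : x ∈ U i) :
    x ∈ U' i ∧ c (nbr (layer G U i) x) = c (nbr (layer G' U' i) x) ∧
      (nbr (layer G U i) x).card = (nbr (layer G' U' i) x).card := by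
  classical
  have hmem : ((⟨i, hi⟩, x, c (nbr (layer G U i) x), ⟨(nbr (layer G U i) x).card,
      Nat.lt_succ_of_le (Finset.card_le_univ _)⟩) :
      Fin M × V × ι × Fin (Fintype.card V + 1)) ∈ clusterSketch c M U G :=
    Finset.mem_image.2 ⟨⟨⟨i, hi⟩, x⟩, by simp [hx], rfl⟩
  rw [h] at hmem
  obtain ⟨⟨j, y⟩, hjy, heq⟩ := Finset.mem_image.1 hmem
  simp only [Prod.mk.injEq, Fin.mk.injEq] at heq
  obtain ⟨rfl, rfl, h1, h2⟩ := heq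
  exact ⟨(Finset.mem_sigma.1 hjy).2, h1.symm, h2.symm⟩

lemma clusters_eq_of_clusterSketch_eq {ι : Type*} {c : Finset V → ι} {M : ℕ}
    {U U' : ℕ → Finset V} {G G' : SimpleGraph V}
    (h : clusterSketch c M U G = clusterSketch c M U' G') (hU : ∀ i, M ≤ i → U i = ∅)
    (hU' : ∀ i, M ≤ i → U' i = ∅) : U = U' := by
  funext i
  rcases lt_or_ge i M with hi | hi
  · exact Finset.ext fun x => ⟨fun hx => (clusterSketch_subset h hi hx).1,
      fun hx => (clusterSketch_subset h.symm hi hx).1⟩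
  · rw [hU i hi, hU' i hi]

/-- The adjacent pairs of a graph, as a finset. -/
noncomputable def adjPairs (G : SimpleGraph V) : Finset (V × V) :=
  open Classical in Finset.univ.filter fun p => G.Adj p.1 p.2

lemma card_adjPairs (G : SimpleGraph V) :
    (adjPairs G).card = adjCount G Finset.univ Finset.univ := by
  classical
  rw [adjCount_eq_card, adjPairs, Finset.univ_product_univ]

lemma exists_walk_of_sketch_eq {q l f : ℕ} (hq : 0 < q) (hf : f ≤ q * q)
    (hl : logWeight (Fintype.card V) ≤ l) {ι : Type*}
    (c : Finset V → ι) (hc : ∀ A B, (open Classical in symmDiff A B).card ≤ 2 * (4 * q) →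
      c A = c B → A = B)
    {M : ℕ} {U : ℕ → Finset V} {G G' : SimpleGraph V} (hU : ∀ i, M ≤ i → U i = ∅)
    (hsk : clusterSketch c M U G = clusterSketch c M U G')
    (hun : adjPairs (uncovered G U) = adjPairs (uncovered G' U))
    (hdense : ∀ i, (U i).Nonempty → ∃ ρ : ℝ, q ≤ ρ ∧ IsDensest (layer G' U i) (U i) ρ)
    {D : Finset (Sym2 V)} (hDf : D.card ≤ f)
    (hD : (D : Set (Sym2 V)) ⊆ G.edgeSet) (hD' : (D : Set (Sym2 V)) ⊆ G'.edgeSet) {x y : V}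
    (hxy : G.Adj x y) (hxyD : s(x, y) ∉ D) :
    ∃ p : (G'.deleteEdges (D : Set (Sym2 V))).Walk x y, p.length ≤ 2 * growthTime l + 2 := by
  classical
  rcases uncovered_or_layer U hxy with hxy' | ⟨i, hi⟩
  · have hmem : (x, y) ∈ adjPairs (uncovered G U) := by simp [adjPairs, hxy']
    rw [hun] at hmem
    have h1 : G'.Adj x y := uncovered_le G' U (Finset.mem_filter.1 hmem).2
    exact ⟨.cons (SimpleGraph.deleteEdges_adj.2 ⟨h1, hxyD⟩) .nil, by simp⟩
  · have hx : x ∈ U i := hi.2.1.1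
    have hy : y ∈ U i := hi.2.1.2
    have hiM : i < M := by
      by_contra hcon
      rw [hU i (not_lt.1 hcon)] at hx
      simp at hx
    obtain ⟨ρ, hqρ, hρ⟩ := hdense i ⟨x, hx⟩
    have hq0 : (0 : ℝ) < q := by exact_mod_cast hq
    obtain ⟨-, hx1, hx2⟩ := clusterSketch_subset hsk hiM hx
    obtain ⟨-, hy1, hy2⟩ := clusterSketch_subset hsk hiM hy
    have hlay : ∀ {a b : V}, s(a, b) ∈ D → InLayer U i a b →
        (layer G U i).Adj a b ∧ (layer G' U i).Adj a b :=
      fun ha hb => ⟨⟨hD ha, hb⟩, ⟨hD' ha, hb⟩⟩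
    have hfD : ((D.filter (· ∈ (layer G U i).edgeSet)).card : ℝ) ≤ q * q := by
      exact_mod_cast (Finset.card_filter_le _ _).trans (hDf.trans hf)
    -- With `K = 4 * q` the requirement on the deletions becomes `4 * D.card ≤ 4 * q * q ≤ ρ * K`.
    obtain ⟨p, hp⟩ := hρ.exists_walk_of_color_eq (L := layer G U i) (hq0.trans_le hqρ)
      (fun a b hab => hab.2.1.1)
      ((logWeight_mono (Finset.card_le_univ _)).trans hl) (K := 4 * q) (by omega) c
      (fun A B h => hc A B (by convert h)) (D := D.filter (· ∈ (layer G U i).edgeSet))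
      (by push_cast; nlinarith)
      (fun e he => (Finset.mem_filter.1 he).2)
      (fun e he => by
        obtain ⟨h1, h2⟩ := Finset.mem_filter.1 (Finset.mem_coe.1 he)
        induction e with
        | _ a b => exact (hlay h1 h2.2).2)
      hx1 hx2 hy1 hy2 hi (fun h => hxyD (Finset.mem_filter.1 h).1)
    -- `InLayer` depends only on the common clusters, so a deleted edge lies in the same layer of
    -- both graphs.
    have hle : (layer G' U i).deleteEdges
        (D.filter (· ∈ (layer G U i).edgeSet) : Finset (Sym2 V)) ≤
        G'.deleteEdges (D : Set (Sym2 V)) := by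
      intro a b hab
      rw [SimpleGraph.deleteEdges_adj] at hab ⊢
      refine ⟨hab.1.1, fun hm => hab.2 ?_⟩
      exact Finset.mem_coe.2 (Finset.mem_filter.2 ⟨hm, (hlay hm hab.1.2).1⟩)
    exact ⟨p.mapLe hle, by simpa using hp⟩

end Sketch

/-! ### The code of an unweighted graph -/

section Code

/-- The length of the code of one unweighted graph. -/
def codeLength (n f : ℕ) : ℕ := 38 * (Nat.sqrt f + 1) * n * logWeight n ^ 3

lemma harmonic_sq_le {n : ℕ} (hn : 1 ≤ n) : (harmonic (n * n) : ℝ) ≤ 2 * logWeight n + 1 := by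
  refine (harmonic_le_one_add_log _).trans ?_
  have h0 : (0 : ℝ) < n := by exact_mod_cast hn
  have h1 : (n : ℝ) ≤ 2 ^ logWeight n := by
    exact_mod_cast (Nat.lt_pow_succ_log_self (by norm_num) n).le
  have h2 : Real.log n ≤ logWeight n * Real.log 2 := by
    rw [← Real.log_pow]
    exact Real.log_le_log h0 h1
  have h3 : Real.log 2 ≤ 1 := by linarith [Real.log_two_lt_d9]
  have h4 : (logWeight n : ℝ) * Real.log 2 ≤ logWeight n * 1 := by gcongr
  push_cast
  rw [Real.log_mul h0.ne' h0.ne']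
  linarith

/-- Every unweighted graph has a code of `codeLength n f` bits from which distances after at most
`f` deletions can be told up to the stretch `2 * growthTime (logWeight n) + 2`. -/
lemma exists_code {n f : ℕ} (hn : 1 ≤ n) :
    ∃ φ : SimpleGraph (Fin n) → List.Vector Bool (codeLength n f),
      ∀ G G' : SimpleGraph (Fin n), φ G = φ G' → ∀ D : Finset (Sym2 (Fin n)), D.card ≤ f →
        (D : Set (Sym2 (Fin n))) ⊆ G.edgeSet → (D : Set (Sym2 (Fin n))) ⊆ G'.edgeSet →
        ∀ x y, G.Adj x y → s(x, y) ∉ D →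
          ∃ p : (G'.deleteEdges (D : Set (Sym2 (Fin n)))).Walk x y,
            p.length ≤ 2 * growthTime (logWeight n) + 2 := by
  classical
  have : Nonempty (Fin n) := ⟨⟨0, hn⟩⟩
  set q := Nat.sqrt f + 1 with hq
  set l := logWeight n with hl
  have hl1 : 1 ≤ l := Nat.succ_pos _
  have hf : f ≤ q * q := (Nat.lt_succ_sqrt f).le
  obtain ⟨c, hc⟩ := exists_finset_coloring (Fin n) (2 * (4 * q))
  have hm : ∀ G : SimpleGraph (Fin n), adjCount G Finset.univ Finset.univ ≤ n * n := by
    intro G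
    rw [adjCount_eq_card]
    refine (Finset.card_filter_le _ _).trans ?_
    simp
  choose U hU0 hUsum hUunc hUd using fun G : SimpleGraph (Fin n) =>
    exists_clusters q _ (Nat.succ_pos _) G rfl
  simp only [Fintype.card_fin, ← hl] at hUsum hUunc
  set N := n * l * (2 * l + 1) with hN
  have hsumN : ∀ G, ∑ i ∈ Finset.range (n * n), (U G i).card ≤ N := by
    intro G
    have h1 := hUsum G (n * n)
    have h2 : (harmonic (adjCount G Finset.univ Finset.univ) : ℝ) ≤ harmonic (n * n) := by
      have : harmonic (adjCount G Finset.univ Finset.univ) ≤ harmonic (n * n) := by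
        refine Finset.sum_le_sum_of_subset_of_nonneg
          (Finset.range_subset_range.2 (hm G)) fun i _ _ => by positivity
      exact_mod_cast this
    have h3 : (n * l * harmonic (adjCount G Finset.univ Finset.univ) : ℝ) ≤
        n * l * (2 * l + 1) := by
      have := h2.trans (harmonic_sq_le hn)
      gcongr
    exact_mod_cast h1.trans h3
  have hU0' : ∀ G i, n * n ≤ i → U G i = ∅ := fun G i hi => hU0 G i ((hm G).trans hi)
  let St := {T : Finset (Fin (n * n) × Fin n × Fin ((Fintype.card (Fin n) + 1) ^ (2 * (4 * q))) ×
    Fin (Fintype.card (Fin n) + 1)) // T.card ≤ N} ×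
    {T : Finset (Fin n × Fin n) // T.card ≤ q * (n * l)}
  let σ : SimpleGraph (Fin n) → St := fun G =>
    (⟨clusterSketch c (n * n) (U G) G, (card_clusterSketch_le _ _ _ _).trans (hsumN G)⟩,
      ⟨adjPairs (uncovered G (U G)), by rw [card_adjPairs]; exact hUunc G⟩)
  have hn2 : n + 1 ≤ 2 ^ l := Nat.lt_pow_succ_log_self (by norm_num) n
  have hcard : Fintype.card St ≤ Fintype.card (List.Vector Bool (codeLength n f)) := by
    rw [card_vector, Fintype.card_bool, ← Nat.card_eq_fintype_card, Nat.card_prod]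
    have hA := card_finset_card_le (Q := Fin (n * n) × Fin n ×
      Fin ((Fintype.card (Fin n) + 1) ^ (2 * (4 * q))) × Fin (Fintype.card (Fin n) + 1)) N
    have hB := card_finset_card_le (Q := Fin n × Fin n) (q * (n * l))
    simp only [Fintype.card_prod, Fintype.card_fin] at hA hB
    -- One sketch entry costs `l * (4 + 8 * q)` bits: `8 * q` factors `n + 1` for the colour, four
    -- for cluster index, vertex and degree.
    have hA' : n * n * (n * ((n + 1) ^ (2 * (4 * q)) * (n + 1))) + 1 ≤
        2 ^ (l * (4 + 8 * q)) := by
      calc n * n * (n * ((n + 1) ^ (2 * (4 * q)) * (n + 1))) + 1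
          ≤ (n + 1) ^ (4 + 8 * q) := by
            have h1 : 1 ≤ (n + 1) ^ (2 * (4 * q)) * (n + 1) :=
              Nat.mul_pos (by positivity) (by omega)
            have h2 : (n + 1) ^ (4 + 8 * q) =
                ((n + 1) * (n + 1) * (n + 1)) * ((n + 1) ^ (2 * (4 * q)) * (n + 1)) := by ring
            rw [h2]
            nlinarith [Nat.zero_le (n * n)]
        _ ≤ (2 ^ l) ^ (4 + 8 * q) := Nat.pow_le_pow_left hn2 _
        _ = 2 ^ (l * (4 + 8 * q)) := by rw [← pow_mul]
    have hB' : n * n + 1 ≤ 2 ^ (l * 2) := by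
      calc n * n + 1 ≤ (n + 1) ^ 2 := by nlinarith
        _ ≤ (2 ^ l) ^ 2 := Nat.pow_le_pow_left hn2 _
        _ = 2 ^ (l * 2) := by rw [← pow_mul]
    refine (Nat.mul_le_mul (hA.trans (Nat.pow_le_pow_left hA' _))
      (hB.trans (Nat.pow_le_pow_left hB' _))).trans ?_
    rw [← pow_mul, ← pow_mul, ← pow_add]
    refine Nat.pow_le_pow_right (by norm_num) ?_
    have hq1 : 1 ≤ q := Nat.succ_pos _
    unfold codeLength
    rw [← hq, ← hl, hN]
    -- The constant is `38 = 12 * 3 + 2`: the sketch contributes `12 * 3`, the uncovered pairs `2`.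
    calc l * (4 + 8 * q) * (n * l * (2 * l + 1)) + l * 2 * (q * (n * l))
        ≤ l * (4 * q + 8 * q) * (n * l * (2 * l + l)) + l * 2 * (q * (n * (l * l))) := by
          gcongr
          · omega
          · nlinarith
      _ = 38 * q * n * l ^ 3 := by ring
  obtain ⟨e⟩ := Function.Embedding.nonempty_of_card_le hcard
  refine ⟨fun G => e (σ G), fun G G' h D hDf hD hD' x y hxy hxyD => ?_⟩
  have hσ := e.injective h
  have h1 : clusterSketch c (n * n) (U G) G = clusterSketch c (n * n) (U G') G' :=
    congrArg (fun t : St => t.1.1) hσ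
  have h2 : adjPairs (uncovered G (U G)) = adjPairs (uncovered G' (U G')) :=
    congrArg (fun t : St => t.2.1) hσ
  have hUU := clusters_eq_of_clusterSketch_eq h1 (hU0' G) (hU0' G')
  rw [hUU] at h1 h2
  exact exists_walk_of_sketch_eq (Nat.succ_pos _) hf (by rw [Fintype.card_fin]) c
    (fun A B hAB => hc A B (by convert hAB)) (hU0' G') h1 h2 (hUd G') hDf hD hD' hxy hxyD

end Code

/-! ### Extremal weights and weighted distances -/

namespace WeightedGraph

variable {n : ℕ}

lemma finite_weights (G : WeightedGraph n) : G.weights.Finite :=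
  (Set.toFinite _).image _

lemma weight_le_wMax (G : WeightedGraph n) {e : Sym2 (Fin n)} (he : e ∈ G.graph.edgeSet) :
    G.weight e ≤ G.wMax :=
  le_csSup G.finite_weights.bddAbove ⟨e, he, rfl⟩

lemma wMin_le_weight (G : WeightedGraph n) {e : Sym2 (Fin n)} (he : e ∈ G.graph.edgeSet)
    (h0 : G.weight e ≠ 0) : G.wMin ≤ G.weight e :=
  csInf_le (OrderBot.bddBelow _) ⟨⟨e, he, rfl⟩, h0⟩

lemma wMin_ne_zero (G : WeightedGraph n) {e : Sym2 (Fin n)} (he : e ∈ G.graph.edgeSet)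
    (h0 : G.weight e ≠ 0) : G.wMin ≠ 0 := by
  have hne : {x | x ∈ G.weights ∧ x ≠ 0}.Nonempty := ⟨_, ⟨e, he, rfl⟩, h0⟩
  exact (hne.csInf_mem (G.finite_weights.subset fun x hx => hx.1)).2

lemma wMin_le_wMax_of_ne_zero (G : WeightedGraph n) (h : G.wMax ≠ 0) :
    G.wMin ≠ 0 ∧ G.wMin ≤ G.wMax := by
  have hne : G.weights.Nonempty := by
    by_contra hcon
    rw [Set.not_nonempty_iff_eq_empty] at hcon
    exact h (by simp [wMax, hcon])
  obtain ⟨e, he, hwe⟩ : G.wMax ∈ G.weights := hne.csSup_mem G.finite_weights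
  have h0 : G.weight e ≠ 0 := by rwa [hwe]
  exact ⟨G.wMin_ne_zero he h0, hwe ▸ G.wMin_le_weight he h0⟩

lemma dist_le_of_walk (G : WeightedGraph n) {u v : Fin n} (p : G.graph.Walk u v) :
    G.dist u v ≤ (((p.edges.map G.weight).sum : ℝ≥0) : ℝ≥0∞) :=
  iInf_le _ p

lemma dist_self (G : WeightedGraph n) (u : Fin n) : G.dist u u = 0 := by
  simpa using G.dist_le_of_walk (.nil : G.graph.Walk u u)

lemma dist_triangle (G : WeightedGraph n) (u v w : Fin n) :
    G.dist u w ≤ G.dist u v + G.dist v w := by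
  unfold dist
  refine ENNReal.le_iInf_add_iInf fun p q => ?_
  refine (G.dist_le_of_walk (p.append q)).trans (le_of_eq ?_)
  rw [SimpleGraph.Walk.edges_append, List.map_append, List.sum_append, ENNReal.coe_add]

/-- Stretch on edges implies stretch on all distances. -/
lemma dist_le_mul_of_adj {G H : WeightedGraph n} {t : ℝ≥0∞}
    (h : ∀ x y, G.graph.Adj x y → H.dist x y ≤ t * G.weight s(x, y)) (u v : Fin n)
    (ht : t ≠ 0) (ht' : t ≠ ∞) : H.dist u v ≤ t * G.dist u v := by
  have hw : ∀ p : G.graph.Walk u v, H.dist u v ≤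
      t * (((p.edges.map G.weight).sum : ℝ≥0) : ℝ≥0∞) := by
    intro p
    induction p with
    | nil => simp [dist_self]
    | @cons a b c hab p ih =>
      rw [SimpleGraph.Walk.edges_cons, List.map_cons, List.sum_cons, ENNReal.coe_add, mul_add]
      exact (H.dist_triangle a b c).trans (add_le_add (h a b hab) ih)
  unfold dist at hw ⊢
  rw [ENNReal.mul_iInf_of_ne ht ht']
  exact le_iInf hw

end WeightedGraph

/-! ### Reduction to weight classes -/

section WeightClasses

/-- The class of a weight: `0` for zero weights, and `j + 1` if the weight lies between `2 ^ j` and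
`2 ^ (j + 1)` units. -/
noncomputable def weightClass (unit w : ℝ≥0) : ℕ :=
  open Classical in if w = 0 then 0 else Nat.log 2 ⌊w / unit⌋₊ + 1

lemma weightClass_zero (unit : ℝ≥0) : weightClass unit 0 = 0 := by simp [weightClass]

lemma weightClass_of_ne_zero (unit : ℝ≥0) {w : ℝ≥0} (h : w ≠ 0) :
    weightClass unit w = Nat.log 2 ⌊w / unit⌋₊ + 1 := by simp [weightClass, h]

lemma le_two_mul_of_weightClass_eq {unit w w' : ℝ≥0}
    (h : w ≠ 0 → unit ≠ 0 ∧ unit ≤ w)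
    (heq : weightClass unit w = weightClass unit w') : w' ≤ 2 * w := by
  by_cases hw' : w' = 0
  · simp [hw']
  rw [weightClass_of_ne_zero unit hw'] at heq
  by_cases hw : w = 0
  · rw [hw, weightClass_zero] at heq
    omega
  rw [weightClass_of_ne_zero unit hw] at heq
  obtain ⟨h0, hle⟩ := h hw
  have hpos : 0 < unit := pos_iff_ne_zero.2 h0
  -- `Nat.log 2 0 = 0` would merge weights below the unit with those near it; `unit ≤ w` excludes
  -- this.
  have h1 : ⌊w / unit⌋₊ ≠ 0 := by
    rw [← Nat.pos_iff_ne_zero, Nat.floor_pos, one_le_div hpos]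
    exact hle
  have h2 : 2 ^ Nat.log 2 ⌊w / unit⌋₊ ≤ ⌊w / unit⌋₊ := Nat.pow_log_le_self 2 h1
  have h3 : ⌊w' / unit⌋₊ + 1 ≤ 2 ^ (Nat.log 2 ⌊w' / unit⌋₊ + 1) :=
    Nat.lt_pow_succ_log_self (by norm_num) _
  have h4 : Nat.log 2 ⌊w' / unit⌋₊ = Nat.log 2 ⌊w / unit⌋₊ := by omega
  rw [h4, pow_succ] at h3
  have h5 : ((⌊w' / unit⌋₊ + 1 : ℕ) : ℝ≥0) ≤ (⌊w / unit⌋₊ * 2 : ℕ) := by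
    exact_mod_cast h3.trans (Nat.mul_le_mul_right 2 h2)
  push_cast at h5
  have h6 : w' / unit ≤ w / unit * 2 :=
    (Nat.lt_floor_add_one _).le.trans (h5.trans (by gcongr; exact Nat.floor_le zero_le))
  rw [div_le_iff₀ hpos] at h6
  calc w' ≤ w / unit * 2 * unit := h6
    _ = 2 * (w / unit * unit) := by ring
    _ = 2 * w := by rw [div_mul_cancel₀ _ h0]

namespace WeightedGraph

variable {n : ℕ}

/-- The edges of `G` whose weight has class `j`. -/
noncomputable def classGraph (G : WeightedGraph n) (j : ℕ) : SimpleGraph (Fin n) where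
  Adj x y := G.graph.Adj x y ∧ weightClass G.wMin (G.weight s(x, y)) = j
  symm := ⟨fun x y h => ⟨h.1.symm, by rw [Sym2.eq_swap]; exact h.2⟩⟩
  loopless := ⟨fun _ h => G.graph.irrefl h.1⟩

lemma mem_edgeSet_classGraph {G : WeightedGraph n} {j : ℕ} {e : Sym2 (Fin n)} :
    e ∈ (G.classGraph j).edgeSet ↔
      e ∈ G.graph.edgeSet ∧ weightClass G.wMin (G.weight e) = j := by
  induction e with
  | _ x y => exact Iff.rfl

/-- The number of weight classes of `G`. -/
noncomputable def numClasses (G : WeightedGraph n) : ℕ :=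
  Nat.log 2 ⌊G.wMax / G.wMin⌋₊ + 2

lemma weightClass_lt_numClasses (G : WeightedGraph n) {e : Sym2 (Fin n)}
    (he : e ∈ G.graph.edgeSet) : weightClass G.wMin (G.weight e) < G.numClasses := by
  unfold numClasses
  by_cases h0 : G.weight e = 0
  · rw [h0, weightClass_zero]
    omega
  · rw [weightClass_of_ne_zero _ h0]
    have h1 := G.weight_le_wMax he
    have h2 : Nat.log 2 ⌊G.weight e / G.wMin⌋₊ ≤ Nat.log 2 ⌊G.wMax / G.wMin⌋₊ :=
      Nat.log_mono_right (Nat.floor_mono (by gcongr))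
    omega

lemma numClasses_le (G : WeightedGraph n) :
    (G.numClasses : ℝ) ≤ 2 * (1 + Real.log ((G.wMax : ℝ) / (G.wMin : ℝ))) := by
  unfold numClasses
  by_cases h : G.wMax = 0
  -- With no edge of positive weight the quotient is `0` and `Real.log 0 = 0`, in agreement with the
  -- convention; both sides equal `2`.
  · simp [h]
  obtain ⟨h0, hle⟩ := G.wMin_le_wMax_of_ne_zero h
  have h1 : 1 ≤ G.wMax / G.wMin := (one_le_div (pos_iff_ne_zero.2 h0)).2 hle
  have h2 : (1 : ℝ) ≤ (⌊G.wMax / G.wMin⌋₊ : ℝ) := by exact_mod_cast Nat.floor_pos.2 h1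
  have h3 : ((⌊G.wMax / G.wMin⌋₊ : ℕ) : ℝ) ≤ (G.wMax : ℝ) / G.wMin := by
    exact_mod_cast Nat.floor_le (a := G.wMax / G.wMin) zero_le
  have h4 : (Nat.log 2 ⌊G.wMax / G.wMin⌋₊ : ℝ) ≤ Real.logb 2 (⌊G.wMax / G.wMin⌋₊ : ℕ) := by
    exact_mod_cast Real.natLog_le_logb ⌊G.wMax / G.wMin⌋₊ 2
  have h5 : Real.log (⌊G.wMax / G.wMin⌋₊ : ℕ) ≤ Real.log ((G.wMax : ℝ) / G.wMin) :=
    Real.log_le_log (by linarith) h3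
  have h6 : 0 ≤ Real.log (⌊G.wMax / G.wMin⌋₊ : ℕ) := Real.log_nonneg h2
  have h7 : Real.logb 2 (⌊G.wMax / G.wMin⌋₊ : ℕ) ≤ 2 * Real.log (⌊G.wMax / G.wMin⌋₊ : ℕ) := by
    rw [Real.logb, div_le_iff₀ (Real.log_pos (by norm_num))]
    nlinarith [Real.log_two_gt_d9]
  push_cast
  linarith

/-- The deleted edges of class `j`. -/
noncomputable def classDeletions (unit : ℝ≥0) (F : Finset (Sym2 (Fin n) × ℝ≥0)) (j : ℕ) :
    Finset (Sym2 (Fin n)) :=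
  open Classical in (F.filter fun p => weightClass unit p.2 = j).image Prod.fst

lemma mem_classDeletions {unit : ℝ≥0} {F : Finset (Sym2 (Fin n) × ℝ≥0)} {j : ℕ}
    {e : Sym2 (Fin n)} :
    e ∈ classDeletions unit F j ↔ ∃ w, (e, w) ∈ F ∧ weightClass unit w = j := by
  simp [classDeletions]

lemma card_classDeletions_le (unit : ℝ≥0) (F : Finset (Sym2 (Fin n) × ℝ≥0)) (j : ℕ) :
    (classDeletions unit F j).card ≤ F.card :=
  Finset.card_image_le.trans (Finset.card_filter_le _ _)

lemma Admissible.classDeletions_subset {G : WeightedGraph n} {F : Finset (Sym2 (Fin n) × ℝ≥0)}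
    (h : G.Admissible F) (j : ℕ) :
    (classDeletions G.wMin F j : Set (Sym2 (Fin n))) ⊆ (G.classGraph j).edgeSet := by
  intro e he
  obtain ⟨w, hw, hj⟩ := mem_classDeletions.1 (Finset.mem_coe.1 he)
  obtain ⟨h1, h2⟩ := h _ hw
  simp only at h1 h2
  exact mem_edgeSet_classGraph.2 ⟨h1, by rw [← h2]; exact hj⟩

lemma Admissible.mem_classDeletions_of_mem {G : WeightedGraph n}
    {F : Finset (Sym2 (Fin n) × ℝ≥0)} (h : G.Admissible F) {j : ℕ} {e : Sym2 (Fin n)}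
    (he : e ∈ Prod.fst '' (F : Set (Sym2 (Fin n) × ℝ≥0)))
    (hj : weightClass G.wMin (G.weight e) = j) : e ∈ classDeletions G.wMin F j := by
  obtain ⟨⟨e', w⟩, hmem, rfl⟩ := he
  have h2 : w = G.weight e' := (h _ hmem).2
  exact mem_classDeletions.2 ⟨w, hmem, by rw [h2]; exact hj⟩

/-- Two graphs whose weight classes have equal codes have similar distances after deletions. -/
lemma dist_delete_le {G G' : WeightedGraph n} (hunit : G.wMin = G'.wMin) {f r : ℕ}
    (hcode : ∀ j < G.numClasses, ∀ D : Finset (Sym2 (Fin n)), D.card ≤ f →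
      (D : Set (Sym2 (Fin n))) ⊆ (G.classGraph j).edgeSet →
      (D : Set (Sym2 (Fin n))) ⊆ (G'.classGraph j).edgeSet →
      ∀ x y, (G.classGraph j).Adj x y → s(x, y) ∉ D →
        ∃ p : ((G'.classGraph j).deleteEdges (D : Set (Sym2 (Fin n)))).Walk x y, p.length ≤ r)
    {F : Finset (Sym2 (Fin n) × ℝ≥0)} (hF : G.Admissible F) (hF' : G'.Admissible F)
    (hFf : F.card ≤ f) {t : ℝ≥0∞} (ht : t ≠ 0) (ht' : t ≠ ∞) (hrt : ((2 * r : ℕ) : ℝ≥0∞) ≤ t)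
    (u v : Fin n) : (G'.delete F).dist u v ≤ t * (G.delete F).dist u v := by
  refine dist_le_mul_of_adj (fun x y hxy => ?_) u v ht ht'
  obtain ⟨hadj, hnF⟩ := SimpleGraph.deleteEdges_adj.1 hxy
  set w := G.weight s(x, y) with hw
  set j := weightClass G.wMin w with hj
  obtain ⟨p, hp⟩ := hcode j (G.weightClass_lt_numClasses hadj) (classDeletions G.wMin F j)
    ((card_classDeletions_le _ _ _).trans hFf) (hF.classDeletions_subset j)
    (by rw [hunit]; exact hF'.classDeletions_subset j) x y ⟨hadj, rfl⟩ (fun hc => by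
      obtain ⟨w', hw', -⟩ := mem_classDeletions.1 hc
      exact hnF ⟨_, hw', rfl⟩)
  have hle : (G'.classGraph j).deleteEdges (classDeletions G.wMin F j : Set (Sym2 (Fin n))) ≤
      (G'.delete F).graph := by
    intro a b hab
    obtain ⟨h1, h2⟩ := SimpleGraph.deleteEdges_adj.1 hab
    refine SimpleGraph.deleteEdges_adj.2 ⟨h1.1, fun hm => h2 ?_⟩
    rw [hunit]
    exact Finset.mem_coe.2 (hF'.mem_classDeletions_of_mem hm h1.2)
  have hweight : ∀ e ∈ p.edges, G'.weight e ≤ 2 * w := by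
    intro e he
    have h1 : e ∈ (G'.classGraph j).edgeSet :=
      SimpleGraph.edgeSet_mono (SimpleGraph.deleteEdges_le _) (p.edges_subset_edgeSet he)
    have h2 := (mem_edgeSet_classGraph.1 h1).2
    rw [← hunit] at h2
    exact le_two_mul_of_weightClass_eq (unit := G.wMin)
      (fun h0 => ⟨G.wMin_ne_zero hadj h0, G.wMin_le_weight hadj h0⟩) h2.symm
  have hsum : ((p.mapLe hle).edges.map G'.weight).sum ≤ (2 * r : ℕ) * w := by
    have h1 : ((p.mapLe hle).edges.map G'.weight).sum ≤
        ((p.mapLe hle).edges.map G'.weight).length • (2 * w) := by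
      refine List.sum_le_card_nsmul _ _ fun z hz => ?_
      obtain ⟨e, he, rfl⟩ := List.mem_map.1 hz
      rw [SimpleGraph.Walk.edges_mapLe_eq_edges] at he
      exact hweight e he
    refine h1.trans ?_
    rw [List.length_map, SimpleGraph.Walk.length_edges, nsmul_eq_mul]
    have h2 : ((p.mapLe hle).length : ℝ≥0) ≤ r := by
      have : (p.mapLe hle).length = p.length := by simp
      rw [this]
      exact_mod_cast hp
    calc ((p.mapLe hle).length : ℝ≥0) * (2 * w) ≤ r * (2 * w) := by gcongr
      _ = (2 * r : ℕ) * w := by push_cast; ring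
  refine ((G'.delete F).dist_le_of_walk (p.mapLe hle)).trans ?_
  calc (((((p.mapLe hle).edges.map G'.weight).sum : ℝ≥0)) : ℝ≥0∞)
      ≤ (((2 * r : ℕ) * w : ℝ≥0) : ℝ≥0∞) := by exact_mod_cast hsum
    _ = ((2 * r : ℕ) : ℝ≥0∞) * w := by push_cast; rfl
    _ ≤ t * w := by gcongr

end WeightedGraph

end WeightClasses

/-! ### The distance oracle -/

section Scheme

lemma flatMap_range_inj {α : Type*} {B : ℕ} {g g' : ℕ → List α} (hg : ∀ i, (g i).length = B)
    (hg' : ∀ i, (g' i).length = B) (b : ℕ)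
    (h : (List.range b).flatMap g = (List.range b).flatMap g') : ∀ j < b, g j = g' j := by
  induction b with
  | zero => intro j hj; omega
  | succ b ih =>
    rw [List.range_succ, List.flatMap_append, List.flatMap_append] at h
    simp only [List.flatMap_cons, List.flatMap_nil, List.append_nil] at h
    obtain ⟨h1, h2⟩ := List.append_inj' h (by rw [hg, hg'])
    intro j hj
    rcases Nat.lt_succ_iff_lt_or_eq.1 hj with hj | rfl
    · exact ih h1 j hj
    · exact h2

lemma length_flatMap_range {α : Type*} {B : ℕ} {g : ℕ → List α} (hg : ∀ i, (g i).length = B)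
    (b : ℕ) : ((List.range b).flatMap g).length = b * B := by
  simp [List.length_flatMap, hg]

/-- The scheme that concatenates the codes of all weight classes, and answers a query by the
largest distance in any graph that is consistent with the stored bits. -/
noncomputable def classScheme {n B : ℕ} (φ : SimpleGraph (Fin n) → List.Vector Bool B) :
    OracleScheme n where
  encode G := (List.range G.numClasses).flatMap fun j => (φ (G.classGraph j)).toList
  query unit bits F u v :=
    ⨆ G : {G : WeightedGraph n // G.wMin = unit ∧ G.Admissible F ∧
      ((List.range G.numClasses).flatMap fun j => (φ (G.classGraph j)).toList) = bits},
      (G.1.delete F).dist u v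

lemma length_encode_classScheme {n B : ℕ} (φ : SimpleGraph (Fin n) → List.Vector Bool B)
    (G : WeightedGraph n) : ((classScheme φ).encode G).length = G.numClasses * B :=
  length_flatMap_range (fun _ => List.Vector.toList_length _) _

/-- The graph itself is among the consistent candidates, which gives the lower bound. Every
candidate shares its code, so the upper bound holds for each one and hence for the supremum. -/
lemma classScheme_isFaultTolerant {n B f r : ℕ} (hB : 0 < B)
    (φ : SimpleGraph (Fin n) → List.Vector Bool B)
    (hφ : ∀ G G' : SimpleGraph (Fin n), φ G = φ G' → ∀ D : Finset (Sym2 (Fin n)), D.card ≤ f →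
      (D : Set (Sym2 (Fin n))) ⊆ G.edgeSet → (D : Set (Sym2 (Fin n))) ⊆ G'.edgeSet →
      ∀ x y, G.Adj x y → s(x, y) ∉ D →
        ∃ p : (G'.deleteEdges (D : Set (Sym2 (Fin n)))).Walk x y, p.length ≤ r)
    {t : ℝ≥0∞} (ht : t ≠ 0) (ht' : t ≠ ∞) (hrt : ((2 * r : ℕ) : ℝ≥0∞) ≤ t) :
    (classScheme φ).IsFaultTolerant f t := by
  intro G F hF hFf u v
  constructor
  · exact le_iSup (fun G : {G' : WeightedGraph n // G'.wMin = G.wMin ∧ G'.Admissible F ∧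
      ((List.range G'.numClasses).flatMap fun j => (φ (G'.classGraph j)).toList) =
        (classScheme φ).encode G} => (G.1.delete F).dist u v) ⟨G, rfl, hF, rfl⟩
  · refine iSup_le ?_
    rintro ⟨G', hunit, hF', hbits⟩
    -- All blocks have the same positive length, so the length of the string reveals their number.
    have hnum : G'.numClasses = G.numClasses := by
      have h1 : ((classScheme φ).encode G').length = ((classScheme φ).encode G).length :=
        congrArg List.length hbits
      rw [length_encode_classScheme, length_encode_classScheme] at h1
      exact Nat.eq_of_mul_eq_mul_right hB h1
    rw [hnum] at hbits
    refine WeightedGraph.dist_delete_le hunit.symm (fun j hj => ?_) hF hF' hFf ht ht' hrt u v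
    refine hφ _ _ (List.Vector.toList_injective ?_)
    exact (flatMap_range_inj (fun _ => List.Vector.toList_length _)
      (fun _ => List.Vector.toList_length _) _ hbits j hj).symm

end Scheme

/-! ### Numerical estimates -/

section Bounds

lemma logWeight_le {n : ℕ} (hn : 2 ≤ n) : (logWeight n : ℝ) ≤ 3 * Real.log n := by
  have h1 : (Nat.log 2 n : ℝ) ≤ Real.logb 2 n := by exact_mod_cast Real.natLog_le_logb n 2
  have h2 : Real.log 2 ≤ Real.log n := Real.log_le_log (by norm_num) (by exact_mod_cast hn)
  have h3 := Real.log_two_gt_d9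
  -- This uses `Real.log 2 > 2 / 3`; the summand `1` of `logWeight` is absorbed likewise, as `n ≥
  -- 2`.
  have h4 : Real.logb 2 n ≤ 3 / 2 * Real.log n := by
    rw [Real.logb, div_le_iff₀ (by linarith)]
    nlinarith
  unfold logWeight
  push_cast
  linarith

lemma growthTime_le {l : ℕ} : (growthTime l : ℝ) ≤ 8 * l * (1 + Real.log l) + l := by
  have h1 : (growthTime l : ℝ) ≤ 8 * l * harmonic l + l := by
    unfold growthTime
    rw [harmonic_eq_sum_Icc, Finset.sum_add_distrib]
    push_cast
    rw [Finset.mul_sum]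
    simp only [Finset.sum_const, Nat.card_Icc, Nat.add_sub_cancel, nsmul_eq_mul, mul_one]
    gcongr with k hk
    rw [← div_eq_mul_inv]
    exact_mod_cast Nat.cast_div_le (α := ℝ) (m := 8 * l) (n := k)
  have h2 := harmonic_le_one_add_log l
  refine h1.trans ?_
  gcongr

lemma stretch_le {n : ℕ} (hn : 2 ≤ n) :
    ((2 * (2 * growthTime (logWeight n) + 2) : ℕ) : ℝ) ≤
      4104 * (Real.log n * max 1 (Real.log (Real.log n))) := by
  have hl := logWeight_le hn
  have hR := growthTime_le (l := logWeight n)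
  have hl1 : (1 : ℝ) ≤ logWeight n := by exact_mod_cast Nat.succ_pos _
  set m := max 1 (Real.log (Real.log n)) with hm
  have hm1 : 1 ≤ m := le_max_left _ _
  have hlog : Real.log (logWeight n) ≤ 3 * m := by
    have h0 : (0 : ℝ) < Real.log n := by linarith
    have h1 : Real.log (logWeight n) ≤ Real.log (3 * Real.log n) :=
      Real.log_le_log (by linarith) hl
    rw [Real.log_mul (by norm_num) h0.ne'] at h1
    have h2 : Real.log 3 ≤ 3 - 1 := Real.log_le_sub_one_of_pos (by norm_num)
    have h3 : Real.log (Real.log n) ≤ m := le_max_right _ _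
    linarith
  have h1 : 8 * (logWeight n : ℝ) * (1 + Real.log (logWeight n)) ≤
      8 * logWeight n * (m + 3 * m) := by gcongr
  have h2 : (logWeight n : ℝ) * 1 ≤ logWeight n * m := by gcongr
  have h3 : (logWeight n : ℝ) * m ≤ 3 * Real.log n * m := by gcongr
  have h4 : 0 ≤ (logWeight n : ℝ) * m := by positivity
  push_cast
  nlinarith

lemma codeLength_le {n f : ℕ} (hn : 2 ≤ n) (hf : 1 ≤ f) :
    (codeLength n f : ℝ) ≤ 2052 * Real.log n ^ 3 * (n * Real.sqrt f) := by
  have hl := logWeight_le hn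
  have h1 : (Nat.sqrt f : ℝ) ≤ Real.sqrt f := Real.nat_sqrt_le_real_sqrt
  have h2 : (1 : ℝ) ≤ Real.sqrt f := Real.one_le_sqrt.2 (by exact_mod_cast hf)
  unfold codeLength
  push_cast
  calc 38 * ((Nat.sqrt f : ℝ) + 1) * n * (logWeight n : ℝ) ^ 3
      ≤ 38 * (Real.sqrt f + Real.sqrt f) * n * (3 * Real.log n) ^ 3 := by gcongr
    _ = 2052 * Real.log n ^ 3 * (n * Real.sqrt f) := by ring

end Bounds

theorem theorem4p3 :
    ∃ (C : ℝ) (c : ℕ), 0 < C ∧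
      ∀ n f : ℕ, 1 ≤ f → f ≤ n.choose 2 →
        ∃ S : OracleScheme n,
          (∀ G : WeightedGraph n,
            ((S.encode G).length : ℝ) ≤
              C * Real.log n ^ c * (n * Real.sqrt f *
                (1 + Real.log ((G.wMax : ℝ) / (G.wMin : ℝ))))) ∧
          S.IsFaultTolerant f
            (ENNReal.ofReal (C * (Real.log n * max 1 (Real.log (Real.log n))))) := by
  -- The space bound dictates `4104 = 2 * 2052`, with `2052 = 38 * 2 * 3 ^ 3`; the stretch alone
  -- would allow a smaller constant.
  refine ⟨4104, 3, by norm_num, fun n f hf hfn => ?_⟩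
  have hn : 2 ≤ n := by
    by_contra hcon
    rw [Nat.choose_eq_zero_of_lt (by omega)] at hfn
    omega
  obtain ⟨φ, hφ⟩ := exists_code (n := n) (f := f) (by omega)
  have hB : 0 < codeLength n f := by
    unfold codeLength logWeight
    positivity
  refine ⟨classScheme φ, fun G => ?_, classScheme_isFaultTolerant hB φ hφ ?_
    ENNReal.ofReal_ne_top ?_⟩
  · rw [length_encode_classScheme]
    have h1 := G.numClasses_le
    have h2 := codeLength_le hn hf
    push_cast
    calc (G.numClasses : ℝ) * codeLength n f
        ≤ (2 * (1 + Real.log ((G.wMax : ℝ) / (G.wMin : ℝ)))) *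
          (2052 * Real.log n ^ 3 * (n * Real.sqrt f)) :=
          mul_le_mul h1 h2 (Nat.cast_nonneg _) ((Nat.cast_nonneg _).trans h1)
      _ = _ := by ring
  · have h := stretch_le hn
    rw [ne_eq, ENNReal.ofReal_eq_zero, not_le]
    refine lt_of_lt_of_le ?_ h
    exact_mod_cast (by omega : 0 < 2 * (2 * growthTime (logWeight n) + 2))
  · rw [← ENNReal.ofReal_natCast]
    exact ENNReal.ofReal_le_ofReal (stretch_le hn)
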